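/- For $z$ in the upper half plane put $q=\exp(2\pi i z)$, $$\theta(z)=\sum_{n\in\mathbb Z}q^{n^2},\qquad \varphi(z)=\theta(z)-\theta\!\left(\tfrac{z+2}{4}\right),$$ and $M=\theta^2$, $N=2\theta\varphi$, $P=\varphi^2$. Let $\mathcal M_k(\Gamma(4))$ denote the complex vector space of (holomorphic) modular forms of weight $k\ge 0$ on the principal congruence subgroup $\Gamma(4)\subset SL(2,\mathbb Z)$. Then $M,N,P$ are modular forms of weight $1$ on $\Gamma(4)$ and $\{M,N,P\}$ is a basis of $\mathcal M_1(\Gamma(4))$. Moreover the graded ring $\bigoplus_{k\ge 0}\mathcal M_k(\Gamma(4))$ is generated as a $\mathbb C$-algebra by $M,N,P$ modulo the single relation $N^2-4MP=0$; that is, the $\mathbb C$-algebra homomorphism $\mathbb C[X,Y,Z]\to\bigoplus_{k\ge 0}\mathcal M_k(\Gamma(4))$ with $X\mapsto M$, $Y\mapsto N$, $Z\mapsto P$ is surjective and its kernel is the ideal $(Y^2-4XZ)$. -/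

import Mathlib

open scoped MatrixGroups DirectSum UpperHalfPlane

noncomputable section

/-- The space `M_k(Γ)` of modular forms of weight `k ≥ 0`. -/
abbrev NModularForm (Γ : Subgroup (GL (Fin 2) ℝ)) (k : ℕ) : Type :=
  ModularForm Γ (k : ℤ)

namespace NModularForm

variable {Γ : Subgroup (GL (Fin 2) ℝ)}

lemma gradedMonoid_ext {a b : GradedMonoid (NModularForm Γ)}
    (h : a.fst = b.fst) (h2 : ∀ z : ℍ, a.snd z = b.snd z) : a = b := by
  obtain ⟨i, a⟩ := a
  obtain ⟨j, b⟩ := b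
  cases h
  exact congrArg _ (ModularForm.ext h2)

instance instGOne (Γ : Subgroup (GL (Fin 2) ℝ)) [Γ.HasDetOne] :
    GradedMonoid.GOne (NModularForm Γ) where
  one := ModularForm.mcast Nat.cast_zero.symm (1 : ModularForm Γ 0)

/-- The product of forms of weights `i` and `j`, as a form of weight `i + j`: the pointwise
product of functions. -/
instance instGMul (Γ : Subgroup (GL (Fin 2) ℝ)) [Γ.HasDetOne] :
    GradedMonoid.GMul (NModularForm Γ) where
  mul {i j} f g := ModularForm.mcast (Nat.cast_add i j).symm (ModularForm.mul f g)

/-- The ring structure on `⨁_{k ≥ 0} M_k(Γ)`. -/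
instance instGCommRing (Γ : Subgroup (GL (Fin 2) ℝ)) [Γ.HasDetOne] :
    DirectSum.GCommRing (NModularForm Γ) where
  one_mul _ := gradedMonoid_ext (zero_add _) (fun _ => one_mul _)
  mul_one _ := gradedMonoid_ext (add_zero _) (fun _ => mul_one _)
  mul_assoc _ _ _ := gradedMonoid_ext (add_assoc _ _ _) (fun _ => mul_assoc _ _ _)
  mul_zero {_ _} _ := ModularForm.ext fun _ => mul_zero _
  zero_mul {_ _} _ := ModularForm.ext fun _ => zero_mul _
  mul_add {_ _} _ _ _ := ModularForm.ext fun _ => mul_add _ _ _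
  add_mul {_ _} _ _ _ := ModularForm.ext fun _ => add_mul _ _ _
  mul_comm _ _ := gradedMonoid_ext (add_comm _ _) (fun _ => mul_comm _ _)
  natCast n := ModularForm.mcast Nat.cast_zero.symm (n : ModularForm Γ 0)
  natCast_zero := ModularForm.ext fun _ => Nat.cast_zero
  natCast_succ _ := ModularForm.ext fun _ => Nat.cast_succ _
  intCast n := ModularForm.mcast Nat.cast_zero.symm (n : ModularForm Γ 0)
  intCast_ofNat _ := ModularForm.ext fun _ => AddGroupWithOne.intCast_ofNat _
  intCast_negSucc_ofNat _ := ModularForm.ext fun _ => AddGroupWithOne.intCast_negSucc _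

/-- The `ℂ`-algebra structure on `⨁_{k ≥ 0} M_k(Γ)`: constants are forms of weight `0`. -/
instance instGAlgebra (Γ : Subgroup (GL (Fin 2) ℝ)) [Γ.HasDetOne] :
    DirectSum.GAlgebra ℂ (NModularForm Γ) where
  toFun :=
    { toFun z := ModularForm.mcast Nat.cast_zero.symm (ModularForm.const z : ModularForm Γ 0)
      map_zero' := rfl
      map_add' := fun _ _ => rfl }
  map_one := rfl
  map_mul _ _ := rfl
  commutes _ _ := gradedMonoid_ext (add_comm _ _) (fun _ => mul_comm _ _)
  smul_def _ _ := gradedMonoid_ext (zero_add _).symm (fun _ => rfl)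

end NModularForm

/-- The principal congruence subgroup `Γ(4)`, inside `GL(2, ℝ)`. -/
abbrev GammaFour : Subgroup (GL (Fin 2) ℝ) :=
  (CongruenceSubgroup.Gamma 4).map (Matrix.SpecialLinearGroup.mapGL ℝ)

/-- `θ(z) = ∑_{n ∈ ℤ} q^{n²}`, with `q = exp(2πiz)`. -/
def thetaFn (z : ℂ) : ℂ := ∑' n : ℤ, Complex.exp (2 * Real.pi * Complex.I * z) ^ (n ^ 2)

/-- `φ(z) = θ(z) - θ((z + 2) / 4)`. -/
def phiFn (z : ℂ) : ℂ := thetaFn z - thetaFn ((z + 2) / 4)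

/-- The `ℂ`-algebra homomorphism `ℂ[X₀, X₁, X₂] → ⨁_{k ≥ 0} M_k(Γ(4))` sending `X₀, X₁, X₂` to
`M, N, P`, placed in degree `1`. -/
def evalForms (M N P : NModularForm GammaFour 1) :
    MvPolynomial (Fin 3) ℂ →ₐ[ℂ] (⨁ k : ℕ, NModularForm GammaFour k) :=
  MvPolynomial.aeval
    (fun i : Fin 3 => DirectSum.of (NModularForm GammaFour) 1 (![M, N, P] i))

end

noncomputable section

open Complex Filter Topology ModularGroup
open scoped Manifold ModularForm
open UpperHalfPlane (qExpansion cuspFunction atImInfty)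
open Function.Periodic (qParam)

/-! The pair (θ, φ) becomes (θ, iφ) under z ↦ z + 1 and w(θ + φ, θ - φ) under z ↦ -1/z, where w² =
-iz/2. Quadratic forms in θ and φ are therefore stable under the weight-one action of SL(2, ℤ), and
the translates of θ² depend only on a bottom row modulo 4 (`thetaTranslate_slash`). This yields
invariance under Γ(4) and boundedness at every cusp at once.

At i∞ one has θ → 1 and φ ~ 2q^{1/4}. The 2k + 1 monomials of weight k in M, N, P with N-degree at
most one thus lead with distinct powers q^{j/4}, 0 ≤ j ≤ 2k, and are independent. Conversely, a form
whose first 2k + 1 coefficients vanish is zero (`eq_zero_of_qExpansion_coeff_eq_zero`), because its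
norm to SL(2, ℤ) vanishes beyond the level-one Sturm bound. So these monomials form a basis in each
weight, which gives surjectivity. Since N² = 4MP reduces every monomial to a multiple of one of
them, there is no further relation. -/

/-! ### Theta series: parity splitting and transformation laws -/

lemma thetaFn_eq_jacobiTheta (z : ℂ) : thetaFn z = jacobiTheta (2 * z) := by
  refine tsum_congr fun n => ?_
  rw [← Complex.exp_int_mul]
  congr 1
  push_cast
  ring

lemma jacobiTheta_summable {τ : ℂ} (hτ : 0 < τ.im) :
    Summable fun n : ℤ => cexp (Real.pi * I * (n : ℂ) ^ 2 * τ) := by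
  refine (hasSum_jacobiTheta₂_term 0 hτ).summable.congr fun n => ?_
  simp [jacobiTheta₂_term]

lemma exp_pi_mul_I_mul_int_sq (n : ℤ) :
    cexp (Real.pi * I * (n : ℂ) ^ 2) = if Even n then 1 else -1 := by
  split_ifs with h
  · obtain ⟨m, rfl⟩ := h
    rw [Complex.exp_eq_one_iff]
    exact ⟨2 * m ^ 2, by push_cast; ring⟩
  · obtain ⟨m, rfl⟩ := Int.not_even_iff_odd.mp h
    rw [← Complex.exp_pi_mul_I, Complex.exp_eq_exp_iff_exists_int]
    exact ⟨2 * m ^ 2 + 2 * m, by push_cast; ring⟩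

/-- Only the even terms survive in the sum of a theta series and its translate by `1`. -/
lemma jacobiTheta_add_jacobiTheta_add_one {τ : ℂ} (hτ : 0 < τ.im) :
    jacobiTheta τ + jacobiTheta (τ + 1) = 2 * jacobiTheta (4 * τ) := by
  have h1 := jacobiTheta_summable hτ
  have h2 := jacobiTheta_summable (τ := τ + 1) (by simpa using hτ)
  have hinj : Function.Injective fun n : ℤ => 2 * n := fun a b h => by simpa using h
  simp only [jacobiTheta]
  rw [← h1.tsum_add h2, ← tsum_mul_left, ← hinj.tsum_eq]
  · refine tsum_congr fun n => ?_
    rw [mul_add, Complex.exp_add, mul_one, exp_pi_mul_I_mul_int_sq, if_pos (by simp), mul_one,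
      ← two_mul]
    congr 2
    push_cast
    ring
  · intro n hn
    by_contra h
    have hodd : ¬ Even n := fun ⟨m, hm⟩ => h ⟨m, by simp only; lia⟩
    refine hn ?_
    beta_reduce
    rw [mul_add, Complex.exp_add, mul_one, exp_pi_mul_I_mul_int_sq, if_neg hodd]
    ring

/-- Parity splitting at τ = z/2, since 2(z + 2)/4 = z/2 + 1. In this form θ + φ is a single theta
value, to which inversion applies. -/
lemma phiFn_eq_sub {z : ℂ} (hz : 0 < z.im) :
    phiFn z = jacobiTheta (z / 2) - thetaFn z := by
  have h := jacobiTheta_add_jacobiTheta_add_one (τ := z / 2) (by simpa using hz)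
  rw [phiFn, thetaFn_eq_jacobiTheta, thetaFn_eq_jacobiTheta]
  rw [show 4 * (z / 2) = 2 * z by ring] at h
  rw [show 2 * ((z + 2) / 4) = z / 2 + 1 by ring]
  linear_combination -h

/-- `φ` is the sum of `q^{m²/4}` over the odd integers `m`. -/
lemma phiFn_eq_jacobiTheta₂ {z : ℂ} (hz : 0 < z.im) :
    phiFn z = cexp (Real.pi * I * z / 2) * jacobiTheta₂ z (2 * z) := by
  have h1 := jacobiTheta_summable (τ := z / 2) (by simpa using hz)
  have h2 := jacobiTheta_summable (τ := z / 2 + 1) (by simpa using hz)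
  have hinj : Function.Injective fun n : ℤ => 2 * n + 1 := fun a b h => by simpa using h
  have h := jacobiTheta_add_jacobiTheta_add_one (τ := z / 2) (by simpa using hz)
  rw [show 4 * (z / 2) = 2 * z by ring] at h
  have key : jacobiTheta (z / 2) - jacobiTheta (z / 2 + 1) =
      2 * (cexp (Real.pi * I * z / 2) * jacobiTheta₂ z (2 * z)) := by
    simp only [jacobiTheta, jacobiTheta₂]
    rw [← h1.tsum_sub h2, ← tsum_mul_left, ← tsum_mul_left, ← hinj.tsum_eq]
    · refine tsum_congr fun n => ?_
      rw [mul_add, Complex.exp_add, mul_one, exp_pi_mul_I_mul_int_sq, if_neg (by simp),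
        jacobiTheta₂_term, ← Complex.exp_add]
      rw [show ∀ x : ℂ, x - x * -1 = 2 * x by intro x; ring]
      congr 2
      push_cast
      ring
    · intro n hn
      by_contra h
      have heven : Even n := by
        by_contra h'
        obtain ⟨m, hm⟩ := Int.not_even_iff_odd.mp h'
        exact h ⟨m, hm.symm⟩
      refine hn ?_
      beta_reduce
      rw [mul_add, Complex.exp_add, mul_one, exp_pi_mul_I_mul_int_sq, if_pos heven]
      ring
  rw [phiFn_eq_sub hz, thetaFn_eq_jacobiTheta]
  linear_combination key / 2 + h / 2

lemma thetaFn_add_one (z : ℂ) : thetaFn (z + 1) = thetaFn z := by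
  simp only [thetaFn_eq_jacobiTheta]
  rw [← jacobiTheta_two_add (2 * z)]
  congr 1
  ring

lemma phiFn_add_one {z : ℂ} (hz : 0 < z.im) : phiFn (z + 1) = I * phiFn z := by
  rw [phiFn_eq_jacobiTheta₂ hz, phiFn_eq_jacobiTheta₂ (by simpa using hz)]
  have h1 : jacobiTheta₂ (z + 1) (2 * (z + 1)) = jacobiTheta₂ z (2 * z) := by
    rw [jacobiTheta₂_add_left, show 2 * (z + 1) = 2 * z + 2 by ring, jacobiTheta₂_add_right]
  rw [h1, ← mul_assoc]
  congr 1
  rw [show Real.pi * I * (z + 1) / 2 = Real.pi / 2 * I + Real.pi * I * z / 2 by ring,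
    Complex.exp_add, Complex.exp_pi_div_two_mul_I]

/-- The transformation of the pair `(θ, φ)` under `z ↦ -1/z`. -/
lemma exists_thetaFn_phiFn_neg_inv (z : ℍ) : ∃ w : ℂ, w ^ 2 = -I * z / 2 ∧
    thetaFn (-(z : ℂ))⁻¹ = w * (thetaFn z + phiFn z) ∧
    phiFn (-(z : ℂ))⁻¹ = w * (thetaFn z - phiFn z) := by
  have main : ∀ z : ℂ, 0 < z.im →
      thetaFn (-z)⁻¹ = (-I * (z / 2)) ^ (1 / 2 : ℂ) * (thetaFn z + phiFn z) := by
    intro z hz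
    have hz2 : 0 < (z / 2).im := by simpa using hz
    have h := jacobiTheta_S_smul ⟨z / 2, hz2⟩
    rw [UpperHalfPlane.modular_S_smul] at h
    have hz0 : z ≠ 0 := by rintro rfl; simp at hz
    -- Inverting z/2 gives -2/z, the argument at which `jacobiTheta` equals θ(-1/z).
    rw [phiFn_eq_sub hz, add_sub_cancel, thetaFn_eq_jacobiTheta]
    convert h using 2
    simp only
    field_simp
  have hz : 0 < (z : ℂ).im := z.im_pos
  have hz0 : (z : ℂ) ≠ 0 := z.ne_zero
  have hzi : 0 < ((-(z : ℂ))⁻¹).im := by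
    have := (ModularGroup.S • z).im_pos
    rwa [UpperHalfPlane.modular_S_smul] at this
  set w : ℂ := (-I * (z / 2)) ^ (1 / 2 : ℂ) with hw
  have hw2 : w ^ 2 = -I * z / 2 := by
    rw [hw, one_div, Complex.cpow_ofNat_inv_pow]
    ring
  have hw0 : w ≠ 0 := by
    intro h
    rw [h] at hw2
    have : (-I * z / 2 : ℂ) ≠ 0 := by
      simp [hz0]
    exact this (by simpa using hw2.symm)
  -- The square roots at z and -1/z multiply to 1/2; the branches agree because -iz/2 has positive
  -- real part.
  have hww : (-I * ((-(z : ℂ))⁻¹ / 2)) ^ (1 / 2 : ℂ) = (2 * w)⁻¹ := by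
    have e1 : (-I * ((-(z : ℂ))⁻¹ / 2)) = ((1 / 4 : ℝ) : ℂ) * (-I * (z / 2))⁻¹ := by
      push_cast
      field_simp
      simp
      norm_num
    have harg : arg (-I * (z / 2)) ≠ Real.pi := by
      intro h
      have := (Complex.arg_eq_pi_iff.mp h).1
      simp at this
      linarith [z.im_pos]
    have e2 : (((1 / 4 : ℝ) : ℂ)) ^ (1 / 2 : ℂ) = 1 / 2 := by
      rw [show (1 / 2 : ℂ) = ((1 / 2 : ℝ) : ℂ) by push_cast; rfl,
        ← Complex.ofReal_cpow (by norm_num)]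
      congr 1
      rw [← Real.sqrt_eq_rpow, show (1 / 4 : ℝ) = (1 / 2) ^ 2 by norm_num,
        Real.sqrt_sq (by norm_num)]
    have hx : (-I * (z / 2))⁻¹ ≠ 0 := by simp [hz0]
    rw [e1, Complex.cpow_def_of_ne_zero (mul_ne_zero (by norm_num) hx),
      Complex.log_ofReal_mul (by norm_num) hx, add_mul, Complex.exp_add,
      ← Complex.cpow_def_of_ne_zero hx, Complex.inv_cpow _ _ harg, ← hw,
      Complex.ofReal_log (by norm_num), ← Complex.cpow_def_of_ne_zero (by norm_num), e2]
    simp [mul_comm]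
  refine ⟨w, hw2, main z hz, ?_⟩
  have h1 := main z hz
  -- The law for φ comes from that for θ at -1/z: it expresses θ(z) through θ(-1/z) + φ(-1/z), and
  -- is solved for φ(-1/z).
  have h2 := main _ hzi
  rw [hww, show (-(-(z : ℂ))⁻¹)⁻¹ = z by simp] at h2
  rw [← hw] at h1
  rw [h1, inv_mul_eq_div, eq_div_iff (mul_ne_zero two_ne_zero hw0)] at h2
  linear_combination -h2

/-! ### Behaviour at i∞ and holomorphy -/

lemma tendsto_im_atImInfty : Tendsto UpperHalfPlane.im UpperHalfPlane.atImInfty atTop :=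
  tendsto_comap

lemma tendsto_thetaFn_atImInfty :
    Tendsto (fun z : ℍ => thetaFn z) UpperHalfPlane.atImInfty (𝓝 1) := by
  have h : Tendsto (fun τ => jacobiTheta τ - 1) (comap im atTop) (𝓝 0) := by
    refine isBigO_at_im_infty_jacobiTheta_sub_one.trans_tendsto ?_
    exact Real.tendsto_exp_atBot.comp
      (tendsto_comap.const_mul_atTop_of_neg (neg_lt_zero.mpr Real.pi_pos))
  have h2 : Tendsto (fun z : ℍ => (2 * z : ℂ)) UpperHalfPlane.atImInfty (comap im atTop) := by
    rw [tendsto_comap_iff]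
    have := tendsto_im_atImInfty.const_mul_atTop (two_pos (α := ℝ))
    refine this.congr fun z => ?_
    simp
  simpa [thetaFn_eq_jacobiTheta] using (h.comp h2).add_const 1

/-- After division by q^{1/4} the n-th term has size |q|^{n² + n}. Only n = 0 and n = -1 survive in
the limit, each contributing 1; for Im z ≥ 1 the terms at z = i dominate. -/
lemma tendsto_phiFn_div_atImInfty :
    Tendsto (fun z : ℍ => phiFn z / Function.Periodic.qParam 4 z)
      UpperHalfPlane.atImInfty (𝓝 2) := by
  have hev : ∀ᶠ z : ℍ in UpperHalfPlane.atImInfty, 1 ≤ z.im :=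
    tendsto_im_atImInfty.eventually_ge_atTop 1
  have hnorm : ∀ (n : ℤ) (z : ℍ), ‖jacobiTheta₂_term n z (2 * z)‖ =
      Real.exp (-(2 * Real.pi * (n ^ 2 + n : ℤ)) * z.im) := fun n z => by
    rw [norm_jacobiTheta₂_term]
    congr 1
    simp
    ring
  have hnn : ∀ n : ℤ, (0 : ℝ) ≤ (n ^ 2 + n : ℤ) := fun n => by
    have : 0 ≤ n ^ 2 + n := by
      rcases le_or_gt 0 n with h | h <;> nlinarith
    exact_mod_cast this
  have hlim := tendsto_tsum_of_dominated_convergence (𝓕 := UpperHalfPlane.atImInfty)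
    (f := fun (z : ℍ) (n : ℤ) => jacobiTheta₂_term n z (2 * z))
    (g := fun n : ℤ => if n ∈ ({0, -1} : Finset ℤ) then (1 : ℂ) else 0)
    (bound := fun n => ‖jacobiTheta₂_term n UpperHalfPlane.I (2 * UpperHalfPlane.I)‖)
    (hasSum_jacobiTheta₂_term _ (by simp)).summable.norm ?_ ?_
  · rw [tsum_eq_sum (s := ({0, -1} : Finset ℤ)) (fun n hn => if_neg hn)] at hlim
    simp only [Finset.mem_insert, Finset.mem_singleton] at hlim
    norm_num at hlim
    refine hlim.congr fun z => ?_
    have hq : Function.Periodic.qParam 4 z = cexp (Real.pi * I * z / 2) := by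
      rw [Function.Periodic.qParam]
      congr 1
      push_cast
      ring
    rw [phiFn_eq_jacobiTheta₂ z.im_pos, hq, mul_div_cancel_left₀ _ (Complex.exp_ne_zero _)]
    rfl
  · intro n
    split_ifs with hn
    · refine tendsto_const_nhds.congr fun z => ?_
      rw [jacobiTheta₂_term, eq_comm]
      simp only [Finset.mem_insert, Finset.mem_singleton] at hn
      rcases hn with rfl | rfl
      · simp
      · rw [← Complex.exp_zero]
        congr 1
        push_cast
        ring
    · rw [tendsto_zero_iff_norm_tendsto_zero]
      simp only [hnorm]
      refine Real.tendsto_exp_atBot.comp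
        (tendsto_im_atImInfty.const_mul_atTop_of_neg ?_)
      have : (0 : ℝ) < (n ^ 2 + n : ℤ) := by
        refine lt_of_le_of_ne (hnn n) fun h => hn ?_
        have h' : n * (n + 1) = 0 := by
          have : n ^ 2 + n = 0 := by exact_mod_cast h.symm
          linear_combination this
        simp only [Finset.mem_insert, Finset.mem_singleton]
        rcases mul_eq_zero.mp h' with h | h <;> lia
      have := Real.pi_pos
      rw [neg_lt_zero]
      positivity
  · filter_upwards [hev] with z hz n
    rw [hnorm, hnorm]
    have := hnn n
    have := Real.pi_pos
    refine Real.exp_le_exp.mpr (mul_le_mul_of_nonpos_left (by simpa using hz) ?_)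
    rw [neg_nonpos]
    positivity

lemma differentiableAt_thetaFn {z : ℂ} (hz : 0 < z.im) : DifferentiableAt ℂ thetaFn z := by
  rw [funext thetaFn_eq_jacobiTheta]
  exact (differentiableAt_jacobiTheta (τ := 2 * z) (by simpa using hz)).comp z (by fun_prop)

lemma differentiableAt_phiFn {z : ℂ} (hz : 0 < z.im) : DifferentiableAt ℂ phiFn z := by
  have h := differentiableAt_thetaFn (z := (z + 2) / 4) (by simpa using hz)
  exact (differentiableAt_thetaFn hz).sub
    (h.comp (f := fun z : ℂ => (z + 2) / 4) z (by fun_prop))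

lemma mdifferentiable_thetaFn : MDiff (fun z : ℍ => thetaFn z) :=
  fun τ => (differentiableAt_thetaFn τ.2).mdifferentiableAt.comp τ τ.mdifferentiable_coe

lemma mdifferentiable_phiFn : MDiff (fun z : ℍ => phiFn z) :=
  fun τ => (differentiableAt_phiFn τ.2).mdifferentiableAt.comp τ τ.mdifferentiable_coe

/-! ### Quadratic forms in θ and φ, and the forms M, N, P -/

/-- The quadratic form `a₀ θ² + a₁ θ φ + a₂ φ²` in `θ` and `φ`. -/
def thetaQuad (a : Fin 3 → ℂ) (z : ℍ) : ℂ :=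
  a 0 * thetaFn z ^ 2 + a 1 * (thetaFn z * phiFn z) + a 2 * phiFn z ^ 2

/-- The action of `z ↦ -1/z` on the coefficients of a quadratic form in `θ` and `φ`. -/
def thetaQuadS (a : Fin 3 → ℂ) : Fin 3 → ℂ :=
  ![-I / 2 * (a 0 + a 1 + a 2), -I * (a 0 - a 2), -I / 2 * (a 0 - a 1 + a 2)]

/-- The action of `z ↦ z + 1` on the coefficients of a quadratic form in `θ` and `φ`. -/
def thetaQuadT (a : Fin 3 → ℂ) : Fin 3 → ℂ := ![a 0, I * a 1, - a 2]

/-- The coefficients of the translates of `θ²` under `SL(2, ℤ)`, indexed by the bottom row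
modulo `4`. -/
def thetaQuadCoeff (x y : ZMod 4) : Fin 3 → ℂ :=
  (![![0, ![1, 0, 0], 0, ![-1, 0, 0]],
    ![![-I / 2, -I, -I / 2], ![-I / 2, 1, I / 2], ![-I / 2, I, -I / 2], ![-I / 2, -1, I / 2]],
    ![0, ![0, 0, 1], 0, ![0, 0, -1]],
    ![![I / 2, I, I / 2], ![I / 2, 1, -I / 2], ![I / 2, -I, I / 2], ![I / 2, -1, -I / 2]]] :
    Fin 4 → Fin 4 → Fin 3 → ℂ) x y

lemma thetaQuadCoeff_eq :
    thetaQuadCoeff 0 0 = 0 ∧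
    thetaQuadCoeff 0 1 = ![1, 0, 0] ∧
    thetaQuadCoeff 0 2 = 0 ∧
    thetaQuadCoeff 0 3 = ![-1, 0, 0] ∧
    thetaQuadCoeff 1 0 = ![-I / 2, -I, -I / 2] ∧
    thetaQuadCoeff 1 1 = ![-I / 2, 1, I / 2] ∧
    thetaQuadCoeff 1 2 = ![-I / 2, I, -I / 2] ∧
    thetaQuadCoeff 1 3 = ![-I / 2, -1, I / 2] ∧
    thetaQuadCoeff 2 0 = 0 ∧
    thetaQuadCoeff 2 1 = ![0, 0, 1] ∧
    thetaQuadCoeff 2 2 = 0 ∧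
    thetaQuadCoeff 2 3 = ![0, 0, -1] ∧
    thetaQuadCoeff 3 0 = ![I / 2, I, I / 2] ∧
    thetaQuadCoeff 3 1 = ![I / 2, 1, -I / 2] ∧
    thetaQuadCoeff 3 2 = ![I / 2, -I, I / 2] ∧
    thetaQuadCoeff 3 3 = ![I / 2, -1, -I / 2] :=
  ⟨rfl, rfl, rfl, rfl, rfl, rfl, rfl, rfl, rfl, rfl, rfl, rfl, rfl, rfl, rfl, rfl⟩

lemma zmod_four_cases : ∀ x : ZMod 4, x = 0 ∨ x = 1 ∨ x = 2 ∨ x = 3 := by decide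

lemma zmod_four_neg : (-1 : ZMod 4) = 3 ∧ (-2 : ZMod 4) = 2 ∧ (-3 : ZMod 4) = 1 := by decide

lemma zmod_four_add : (1 + 1 : ZMod 4) = 2 ∧ (1 + 2 : ZMod 4) = 3 ∧ (1 + 3 : ZMod 4) = 0 ∧
    (2 + 1 : ZMod 4) = 3 ∧ (2 + 2 : ZMod 4) = 0 ∧ (2 + 3 : ZMod 4) = 1 ∧
    (3 + 1 : ZMod 4) = 0 ∧ (3 + 2 : ZMod 4) = 1 ∧ (3 + 3 : ZMod 4) = 2 := by decide

/-- The table is equivariant: (y, -x) is the row (x, y) times S. The analogue for T sends (x, y) to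
(x, x + y). -/
lemma thetaQuadS_thetaQuadCoeff (x y : ZMod 4) :
    thetaQuadS (thetaQuadCoeff x y) = thetaQuadCoeff y (-x) := by
  have hI := Complex.I_mul_I
  rcases zmod_four_cases x with rfl | rfl | rfl | rfl <;>
  rcases zmod_four_cases y with rfl | rfl | rfl | rfl <;>
  simp only [neg_zero, zmod_four_neg, thetaQuadCoeff_eq] <;>
  ext i <;> fin_cases i <;> simp [thetaQuadS] <;> grind

lemma thetaQuadT_thetaQuadCoeff (x y : ZMod 4) :
    thetaQuadT (thetaQuadCoeff x y) = thetaQuadCoeff x (x + y) := by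
  have hI := Complex.I_mul_I
  rcases zmod_four_cases x with rfl | rfl | rfl | rfl <;>
  rcases zmod_four_cases y with rfl | rfl | rfl | rfl <;>
  simp only [add_zero, zero_add, zmod_four_add, thetaQuadCoeff_eq] <;>
  ext i <;> fin_cases i <;> simp [thetaQuadT] <;> grind

lemma thetaQuad_slash_S (a : Fin 3 → ℂ) :
    thetaQuad a ∣[(1 : ℤ)] S = thetaQuad (thetaQuadS a) := by
  ext z
  obtain ⟨w, hw, h1, h2⟩ := exists_thetaFn_phiFn_neg_inv z
  have hz : (z : ℂ) ≠ 0 := z.ne_zero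
  have hd : UpperHalfPlane.denom (S : GL (Fin 2) ℝ) z = z := by
    simpa [S] using ModularGroup.denom_apply S z
  rw [ModularForm.SL_slash_apply, UpperHalfPlane.modular_S_smul, hd]
  simp only [thetaQuad, thetaQuadS, h1, h2, mul_pow, hw]
  simp
  field_simp
  linear_combination 2 * (a 1) * (thetaFn z ^ 2 - phiFn z ^ 2) * hw

lemma thetaQuad_slash_T (a : Fin 3 → ℂ) :
    thetaQuad a ∣[(1 : ℤ)] T = thetaQuad (thetaQuadT a) := by
  ext z
  rw [ModularForm.SL_slash_apply, UpperHalfPlane.modular_T_smul]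
  have hd : UpperHalfPlane.denom (T : GL (Fin 2) ℝ) z = 1 := by
    simpa [T] using ModularGroup.denom_apply T z
  have hI := Complex.I_sq
  rw [hd]
  simp only [thetaQuad, thetaQuadT, UpperHalfPlane.coe_vadd, Complex.ofReal_one, add_comm (1 : ℂ),
    thetaFn_add_one, phiFn_add_one z.im_pos]
  simp [mul_pow]
  ring

/-- The translates of `θ²` under `SL(2, ℤ)`. -/
def thetaTranslate (v : Fin 2 → ZMod 4) : ℍ → ℂ := thetaQuad (thetaQuadCoeff (v 0) (v 1))

/-- Reduction of a matrix modulo `4`. -/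
abbrev modFour (γ : SL(2, ℤ)) : Matrix (Fin 2) (Fin 2) (ZMod 4) :=
  (γ : Matrix (Fin 2) (Fin 2) ℤ).map (Int.castRingHom (ZMod 4))

lemma modFour_one : modFour 1 = 1 := by simp [modFour]

lemma modFour_mul (γ δ : SL(2, ℤ)) : modFour (γ * δ) = modFour γ * modFour δ := by
  rw [modFour, Matrix.SpecialLinearGroup.coe_mul, Matrix.map_mul]

open Matrix in
lemma thetaTranslate_slash (γ : SL(2, ℤ)) : ∀ v : Fin 2 → ZMod 4,
    thetaTranslate v ∣[(1 : ℤ)] γ = thetaTranslate (v ᵥ* modFour γ) := by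
  have hγ : γ ∈ Subgroup.closure {S, T} := by simp [SpecialLinearGroup.SL2Z_generators]
  induction hγ using Subgroup.closure_induction with
  | mem x hx =>
    intro v
    rcases hx with rfl | rfl
    · rw [thetaTranslate, thetaQuad_slash_S, thetaQuadS_thetaQuadCoeff, thetaTranslate]
      simp [modFour, S, Matrix.vecMul, dotProduct, Fin.sum_univ_two]
    · rw [thetaTranslate, thetaQuad_slash_T, thetaQuadT_thetaQuadCoeff, thetaTranslate]
      simp [modFour, T, Matrix.vecMul, dotProduct, Fin.sum_univ_two]
  | one => intro v; rw [modFour_one, vecMul_one, SlashAction.slash_one]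
  | mul x y _ _ hx hy =>
    intro v
    rw [SlashAction.slash_mul, hx, hy, modFour_mul, vecMul_vecMul]
  | inv x _ hx =>
    intro v
    have h := hx (v ᵥ* modFour x⁻¹)
    rw [vecMul_vecMul, ← modFour_mul, inv_mul_cancel, modFour_one, vecMul_one] at h
    rw [← h, ← SlashAction.slash_mul, mul_inv_cancel, SlashAction.slash_one]

lemma mdifferentiable_thetaQuad (a : Fin 3 → ℂ) : MDiff (thetaQuad a) := by
  have h1 := mdifferentiable_thetaFn
  have h2 := mdifferentiable_phiFn
  exact ((mdifferentiable_const.mul (h1.pow 2)).add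
    (mdifferentiable_const.mul (h1.mul h2))).add (mdifferentiable_const.mul (h2.pow 2))

lemma tendsto_phiFn_atImInfty :
    Tendsto (fun z : ℍ => phiFn z) UpperHalfPlane.atImInfty (𝓝 0) := by
  have h := tendsto_phiFn_div_atImInfty.mul
    (UpperHalfPlane.qParam_tendsto_atImInfty (h := 4) (by norm_num))
  rw [mul_zero] at h
  refine h.congr fun z => div_mul_cancel₀ _ (Function.Periodic.qParam_ne_zero _)

lemma isBoundedAtImInfty_thetaQuad (a : Fin 3 → ℂ) :
    UpperHalfPlane.IsBoundedAtImInfty (thetaQuad a) := by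
  have h1 := tendsto_thetaFn_atImInfty
  have h2 := tendsto_phiFn_atImInfty
  exact ((((h1.pow 2).const_mul (a 0)).add ((h1.mul h2).const_mul (a 1))).add
    ((h2.pow 2).const_mul (a 2))).isBigO_one ℝ

/-- The translates of `θ²` under `SL(2, ℤ)`, as modular forms on `Γ(4)`. -/
def thetaTranslateForm (v : Fin 2 → ZMod 4) : NModularForm GammaFour 1 where
  toFun := thetaTranslate v
  slash_action_eq' := by
    rintro _ ⟨γ, hγ, rfl⟩
    change thetaTranslate v ∣[(1 : ℤ)] γ = _
    have h : modFour γ = 1 := by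
      have := CongruenceSubgroup.Gamma_mem'.mp hγ
      exact congrArg Subtype.val this
    rw [thetaTranslate_slash, h, Matrix.vecMul_one]
  holo' := mdifferentiable_thetaQuad _
  bdd_at_cusps' := by
    intro c hc
    rw [Subgroup.IsArithmetic.isCusp_iff_isCusp_SL2Z] at hc
    rw [OnePoint.isBoundedAt_iff_forall_SL2Z hc]
    -- Every translate is again a quadratic form in θ and φ, so boundedness at i∞ settles all cusps.
    intro γ _
    change UpperHalfPlane.IsBoundedAtImInfty (thetaTranslate v ∣[(1 : ℤ)] γ)
    rw [thetaTranslate_slash]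
    exact isBoundedAtImInfty_thetaQuad _

/-- The form `M = θ²`. -/
def formM : NModularForm GammaFour 1 := thetaTranslateForm ![0, 1]

/-- The form `N = 2θφ`. -/
def formN : NModularForm GammaFour 1 :=
  -- The two translates differ by -2iθφ.
  I • (thetaTranslateForm ![1, 0] - thetaTranslateForm ![1, 2])

/-- The form `P = φ²`. -/
def formP : NModularForm GammaFour 1 := thetaTranslateForm ![2, 1]

lemma formM_apply (z : ℍ) : formM z = thetaFn z ^ 2 := by
  change thetaQuad (thetaQuadCoeff 0 1) z = _
  simp only [thetaQuadCoeff_eq]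
  simp [thetaQuad]

lemma formN_apply (z : ℍ) : formN z = 2 * thetaFn z * phiFn z := by
  change I * (thetaQuad (thetaQuadCoeff 1 0) z - thetaQuad (thetaQuadCoeff 1 2) z) = _
  simp only [thetaQuadCoeff_eq]
  simp [thetaQuad]
  linear_combination (-2 * thetaFn z * phiFn z) * Complex.I_mul_I

lemma formP_apply (z : ℍ) : formP z = phiFn z ^ 2 := by
  change thetaQuad (thetaQuadCoeff 2 1) z = _
  simp only [thetaQuadCoeff_eq]
  simp [thetaQuad]

/-! ### Coefficients of q-expansions and growth at i∞ -/

/-- If G had order n ≤ m at 0, then G/qⁿ would have a nonzero limit, yet it equals (G/q^m) ·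
q^{m-n}, which tends to 0. -/
lemma iteratedDeriv_eq_zero_of_tendsto_div_pow {G : ℂ → ℂ} (hG : AnalyticAt ℂ G 0) {m : ℕ}
    (h : Tendsto (fun q => G q / q ^ m) (𝓝[≠] 0) (𝓝 0)) {i : ℕ} (hi : i ≤ m) :
    iteratedDeriv i G 0 = 0 := by
  suffices H : ((m + 1 : ℕ) : ℕ∞) ≤ analyticOrderAt G 0 from
    (natCast_le_analyticOrderAt_iff_iteratedDeriv_eq_zero hG).mp H i (Nat.lt_succ_of_le hi)
  by_contra! hlt
  obtain ⟨n, hn⟩ := ENat.ne_top_iff_exists.mp hlt.ne_top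
  rw [← hn] at hlt
  have hnm : n ≤ m := Nat.lt_succ_iff.mp (by exact_mod_cast hlt)
  obtain ⟨g, hg, hg0, hGg⟩ := hG.analyticOrderAt_eq_natCast.mp hn.symm
  refine hg0 (tendsto_nhds_unique (hg.continuousAt.tendsto.mono_left nhdsWithin_le_nhds)
    (l := 𝓝[≠] 0) ?_)
  have h1 : Tendsto (fun q : ℂ => q ^ (m - n)) (𝓝[≠] 0) (𝓝 (0 ^ (m - n))) :=
    ((continuous_pow (m - n)).tendsto 0).mono_left nhdsWithin_le_nhds
  have h2 := h.mul h1
  rw [zero_mul] at h2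
  refine h2.congr' ?_
  filter_upwards [hGg.filter_mono nhdsWithin_le_nhds, self_mem_nhdsWithin] with q hq hq0
  have hq0 : q ≠ 0 := hq0
  rw [hq, sub_zero, smul_eq_mul, ← Nat.sub_add_cancel hnm, pow_add, Nat.add_sub_cancel]
  field_simp

lemma iteratedDeriv_of_tendsto_div_pow {F : ℂ → ℂ} (hF : AnalyticAt ℂ F 0) {m : ℕ} {c : ℂ}
    (h : Tendsto (fun q => F q / q ^ m) (𝓝[≠] 0) (𝓝 c)) {i : ℕ} (hi : i ≤ m) :
    (i.factorial : ℂ)⁻¹ * iteratedDeriv i F 0 = if i = m then c else 0 := by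
  have hP : AnalyticAt ℂ (fun q : ℂ => c * q ^ m) 0 := by fun_prop
  have h0 : Tendsto (fun q => (F - fun q => c * q ^ m) q / q ^ m) (𝓝[≠] 0) (𝓝 0) := by
    have := h.sub_const c
    rw [sub_self] at this
    refine this.congr' ?_
    filter_upwards [self_mem_nhdsWithin] with q hq
    have hq : q ≠ 0 := hq
    simp only [Pi.sub_apply]
    field_simp
  have h1 := iteratedDeriv_eq_zero_of_tendsto_div_pow (hF.sub hP) h0 hi
  rw [iteratedDeriv_sub hF.contDiffAt hP.contDiffAt, sub_eq_zero] at h1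
  rw [h1, iteratedDeriv_const_mul_field]
  rw [iteratedDeriv_fun_pow_zero]
  have : (i.factorial : ℂ) ≠ 0 := by exact_mod_cast i.factorial_ne_zero
  split_ifs with him
  · subst him
    field_simp
  · simp

variable {Γ : Subgroup (GL (Fin 2) ℝ)} {k : ℤ} {h : ℝ}

/-- The leading coefficients of a `q`-expansion can be read off from the asymptotic behaviour
at `i∞`. -/
lemma qExpansion_coeff_of_tendsto (hh : 0 < h) (hΓ : h ∈ Γ.strictPeriods) (f : ModularForm Γ k)
    {m : ℕ} {c : ℂ} (hf : Tendsto (fun τ : ℍ => f τ / qParam h τ ^ m) atImInfty (𝓝 c))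
    {i : ℕ} (hi : i ≤ m) : (qExpansion h f).coeff i = if i = m then c else 0 := by
  rw [UpperHalfPlane.qExpansion_coeff]
  refine iteratedDeriv_of_tendsto_div_pow
    (ModularFormClass.analyticAt_cuspFunction_zero f hh hΓ) ?_ hi
  have h1 := hf.comp (UpperHalfPlane.tendsto_comap_im_ofComplex.comp
    (Function.Periodic.invQParam_tendsto hh))
  refine h1.congr' ?_
  have hball : ∀ᶠ q : ℂ in 𝓝[≠] 0, ‖q‖ < 1 := by
    refine Filter.Eventually.filter_mono nhdsWithin_le_nhds ?_
    exact (continuous_norm.tendsto (0 : ℂ)).eventually_lt_const (by simp)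
  filter_upwards [self_mem_nhdsWithin, hball] with q hq0 hq1
  have hq0 : q ≠ 0 := hq0
  have him := Function.Periodic.im_invQParam_pos_of_norm_lt_one hh hq1 hq0
  simp only [Function.comp_apply, cuspFunction, Function.Periodic.cuspFunction_eq_of_nonzero _ _ hq0]
  rw [UpperHalfPlane.ofComplex_apply_of_im_pos him]
  simp only [Function.Periodic.qParam_right_inv hh.ne' hq0]

/-- A form whose first `m` coefficients vanish is `O(q^m)` at `i∞`. -/
lemma isBigO_of_qExpansion_coeff_eq_zero (hh : 0 < h) (hΓ : h ∈ Γ.strictPeriods)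
    (f : ModularForm Γ k) {m : ℕ} (hf : ∀ i < m, (qExpansion h f).coeff i = 0) :
    (f : ℍ → ℂ) =O[atImInfty] fun τ => qParam h τ ^ m := by
  have hF := ModularFormClass.analyticAt_cuspFunction_zero f hh hΓ
  have hord : (m : ℕ∞) ≤ analyticOrderAt (cuspFunction h f) 0 := by
    rw [natCast_le_analyticOrderAt_iff_iteratedDeriv_eq_zero hF]
    intro i hi
    have := hf i hi
    rw [UpperHalfPlane.qExpansion_coeff] at this
    simpa [Nat.factorial_ne_zero] using this
  obtain ⟨g, hg, hFg⟩ := (natCast_le_analyticOrderAt hF).mp hord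
  have hO : cuspFunction h f =O[𝓝 0] fun q : ℂ => q ^ m := by
    have h1 : g =O[𝓝 0] fun _ => (1 : ℂ) := hg.continuousAt.tendsto.isBigO_one ℂ
    have h2 := (Asymptotics.isBigO_refl (fun q : ℂ => q ^ m) (𝓝 0)).mul h1
    refine (h2.congr' ?_ ?_)
    · filter_upwards [hFg] with q hq
      rw [hq, sub_zero, smul_eq_mul]
    · filter_upwards with q
      rw [mul_one]
  refine (hO.comp_tendsto (UpperHalfPlane.qParam_tendsto_atImInfty hh)).congr_left fun τ => ?_
  exact SlashInvariantFormClass.eq_cuspFunction f τ hΓ hh.ne'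

/-! ### Vanishing bound on Γ(4) through the norm to SL(2, ℤ) -/

lemma card_SL_two_zmod_four_le : Nat.card SL(2, ZMod 4) ≤ 48 := by
  have hcard : ((Finset.univ : Finset (ZMod 4 × ZMod 4 × ZMod 4 × ZMod 4)).filter
      fun t => t.1 * t.2.2.2 - t.2.1 * t.2.2.1 = 1).card = 48 := by decide +kernel
  rw [← hcard, Nat.card_eq_fintype_card, ← Finset.card_univ]
  refine Finset.card_le_card_of_injOn (fun A => (A 0 0, A 0 1, A 1 0, A 1 1)) ?_ ?_
  · intro A _
    have := A.det_coe
    rw [Matrix.det_fin_two] at this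
    simpa using this
  · intro A _ B _ h
    simp only [Prod.mk.injEq] at h
    ext i j
    fin_cases i <;> fin_cases j <;> simp [h]

lemma card_quotient_GammaFour_le :
    Nat.card (𝒮ℒ ⧸ GammaFour.subgroupOf 𝒮ℒ) ≤ 48 := by
  have h1 : Nat.card (𝒮ℒ ⧸ GammaFour.subgroupOf 𝒮ℒ) = (CongruenceSubgroup.Gamma 4).index := by
    change GammaFour.relIndex 𝒮ℒ = _
    rw [MonoidHom.range_eq_map, Subgroup.relIndex_map_map_of_injective _ _
      Matrix.SpecialLinearGroup.mapGL_injective, Subgroup.relIndex_top_right]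
  rw [h1, CongruenceSubgroup.Gamma, Subgroup.index_ker]
  exact (Nat.card_le_card_of_injective _ Subtype.val_injective).trans card_SL_two_zmod_four_le

/-- The matrices `±T^j` with `0 ≤ j < 4`. -/
def signedTranslation (p : Fin 2 × Fin 4) : SL(2, ℤ) :=
  ⟨!![(-1) ^ (p.1 : ℕ), (-1) ^ (p.1 : ℕ) * (p.2 : ℕ); 0, (-1) ^ (p.1 : ℕ)], by
    rw [Matrix.det_fin_two_of, ← mul_pow]; simp⟩

lemma signedTranslation_injective_mod_four : Function.Injective fun p : Fin 2 × Fin 4 =>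
    ((((signedTranslation p) 0 0 : ℤ) : ZMod 4), (((signedTranslation p) 0 1 : ℤ) : ZMod 4)) := by
  decide

/-- The coset of an element of `SL(2, ℤ)` modulo `Γ(4)`. -/
def cosetGammaFour (γ : SL(2, ℤ)) : 𝒮ℒ ⧸ GammaFour.subgroupOf 𝒮ℒ :=
  QuotientGroup.mk ⟨Matrix.SpecialLinearGroup.mapGL ℝ γ, γ, rfl⟩

lemma cosetGammaFour_eq_iff {γ δ : SL(2, ℤ)} :
    cosetGammaFour γ = cosetGammaFour δ ↔ γ⁻¹ * δ ∈ CongruenceSubgroup.Gamma 4 := by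
  rw [cosetGammaFour, cosetGammaFour, QuotientGroup.eq, Subgroup.mem_subgroupOf]
  simp only [Subgroup.coe_mul, Subgroup.coe_inv, ← map_inv, ← map_mul]
  exact Subgroup.mem_map_iff_mem Matrix.SpecialLinearGroup.mapGL_injective

lemma cosetGammaFour_signedTranslation_injective :
    Function.Injective fun p => cosetGammaFour (signedTranslation p) := by
  intro p p' h
  rw [cosetGammaFour_eq_iff, CongruenceSubgroup.Gamma_mem', map_mul, map_inv,
    inv_mul_eq_one] at h
  refine signedTranslation_injective_mod_four ?_
  have h' := congrArg Subtype.val h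
  exact Prod.ext (congrFun (congrFun h' 0) 0) (congrFun (congrFun h' 0) 1)

/-- Slashing by an upper triangular matrix does not change the order of growth at `i∞`. -/
lemma isBigO_slash_of_upperTriangular {f : ℍ → ℂ} {γ : SL(2, ℤ)} (hγ : γ 1 0 = 0) {k : ℤ}
    {h : ℝ} {m : ℕ} (hf : f =O[atImInfty] fun τ => qParam h τ ^ m) :
    (f ∣[k] γ) =O[atImInfty] fun τ => qParam h τ ^ m := by
  have hdet : γ 0 0 * γ 1 1 = 1 := by
    have := γ.det_coe
    rw [Matrix.det_fin_two, hγ] at this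
    linarith
  have hd : ‖((γ 1 1 : ℤ) : ℂ)‖ = 1 := by
    rcases Int.isUnit_iff.mp (IsUnit.of_mul_eq_one_right _ hdet) with h | h <;> simp [h]
  have hdenom : ∀ τ : ℍ, UpperHalfPlane.denom (γ : GL (Fin 2) ℝ) τ = γ 1 1 := fun τ => by
    simpa [hγ] using ModularGroup.denom_apply γ τ
  have him : ∀ τ : ℍ, (γ • τ).im = τ.im := fun τ => by
    rw [ModularGroup.im_smul_eq_div_normSq, hdenom, Complex.normSq_eq_norm_sq, hd]
    simp
  have ht : Tendsto (fun τ : ℍ => γ • τ) atImInfty atImInfty := by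
    rw [UpperHalfPlane.atImInfty, tendsto_comap_iff]
    exact tendsto_comap.congr fun τ => (him τ).symm
  have h1 := hf.comp_tendsto ht
  refine Asymptotics.IsBigO.of_norm_norm (h1.norm_norm.congr (fun τ => ?_) (fun τ => ?_))
  · rw [ModularForm.SL_slash_apply, hdenom, norm_mul, norm_zpow]
    simp only [hd, one_zpow, mul_one, Function.comp_apply]
  · simp only [Function.comp_apply, norm_pow, Function.Periodic.norm_qParam,
      UpperHalfPlane.coe_im, him]

lemma four_mem_strictPeriods_GammaFour : (4 : ℝ) ∈ GammaFour.strictPeriods := by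
  rw [CongruenceSubgroup.strictPeriods_Gamma]
  exact AddSubgroup.mem_zmultiples _

open Classical in
/-- A form on `Γ(4)` of weight `k` vanishing to order more than `2 k` at `i∞` is zero. -/
lemma eq_zero_of_qExpansion_coeff_eq_zero {k : ℕ} (f : NModularForm GammaFour k)
    (hf : ∀ i < 2 * k + 1, (qExpansion 4 f).coeff i = 0) : f = 0 := by
  have hO := isBigO_of_qExpansion_coeff_eq_zero (by norm_num) four_mem_strictPeriods_GammaFour f hf
  -- The cosets of ±T^j stabilise i∞, so the corresponding factors of the norm vanish as fast as f;
  -- the remaining factors are merely bounded.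
  let S : Finset (𝒮ℒ ⧸ GammaFour.subgroupOf 𝒮ℒ) :=
    Finset.univ.image fun p => cosetGammaFour (signedTranslation p)
  have hS : S.card = 8 := by
    rw [Finset.card_image_of_injective _ cosetGammaFour_signedTranslation_injective]
    rfl
  let := Fintype.ofFinite (𝒮ℒ ⧸ GammaFour.subgroupOf 𝒮ℒ)
  have hfac : ∀ q ∈ (Finset.univ : Finset (𝒮ℒ ⧸ GammaFour.subgroupOf 𝒮ℒ)),
      SlashInvariantForm.quotientFunc f q =O[atImInfty]
        fun τ : ℍ => if q ∈ S then qParam 4 τ ^ (2 * k + 1) else 1 := by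
    intro q _
    split_ifs with hq
    · obtain ⟨p, -, rfl⟩ := Finset.mem_image.mp hq
      have : SlashInvariantForm.quotientFunc f (cosetGammaFour (signedTranslation p)) =
          (f : ℍ → ℂ) ∣[(k : ℤ)] (signedTranslation p)⁻¹ := by
        rw [ModularForm.SL_slash, map_inv]
        rfl
      rw [this]
      refine isBigO_slash_of_upperTriangular ?_ hO
      rw [Matrix.SpecialLinearGroup.coe_inv, Matrix.adjugate_fin_two]
      simp [signedTranslation]
    · obtain ⟨⟨_, γ, rfl⟩, rfl⟩ := QuotientGroup.mk_surjective q
      have : SlashInvariantForm.quotientFunc f (cosetGammaFour γ) = (f : ℍ → ℂ) ∣[(k : ℤ)] γ⁻¹ := by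
        rw [ModularForm.SL_slash, map_inv]
        rfl
      change SlashInvariantForm.quotientFunc f (cosetGammaFour γ) =O[atImInfty] _
      rw [this]
      have hb := ModularFormClass.bdd_at_infty_slash f γ⁻¹
      refine Asymptotics.IsBigO.trans hb ?_
      exact Asymptotics.isBigO_const_const _ one_ne_zero _
  have hprod := Asymptotics.IsBigO.finsetProd hfac
  -- Eight factors of order 2k + 1 in q^{1/4} give 16k + 8 = 4 · 4k + 8. The surplus 8 also kills
  -- the coefficient of index 4k.
  have hnorm : (ModularForm.norm 𝒮ℒ f : ℍ → ℂ) =O[atImInfty]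
      fun τ : ℍ => qParam 1 τ ^ (4 * k) * qParam 4 τ ^ 8 := by
    refine hprod.congr (fun τ => ?_) (fun τ => ?_)
    · rw [ModularForm.coe_norm, Finset.prod_apply]
    · rw [Finset.prod_ite_mem, Finset.univ_inter, Finset.prod_const, hS]
      have : qParam 1 τ = qParam 4 τ ^ 4 := by
        rw [qParam, qParam, ← Complex.exp_nat_mul]
        congr 1
        push_cast
        ring
      rw [this]
      ring
  have hlim : Tendsto (fun τ : ℍ => ModularForm.norm 𝒮ℒ f τ / qParam 1 τ ^ (4 * k))
      atImInfty (𝓝 0) := by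
    have h8 : Tendsto (fun τ : ℍ => qParam 4 τ ^ 8) atImInfty (𝓝 0) := by
      simpa using (UpperHalfPlane.qParam_tendsto_atImInfty (h := 4) (by norm_num)).pow 8
    refine Asymptotics.IsBigO.trans_tendsto ?_ h8
    have h2 := hnorm.mul (Asymptotics.isBigO_refl (fun τ : ℍ => (qParam 1 τ ^ (4 * k))⁻¹) atImInfty)
    refine h2.congr (fun τ => rfl) (fun τ => ?_)
    have := pow_ne_zero (4 * k) (Function.Periodic.qParam_ne_zero (h := 1) τ)
    field_simp
  have hcoeff : ((4 * k + 1 : ℕ) : ℕ∞) ≤ (qExpansion 1 (ModularForm.norm 𝒮ℒ f)).order := by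
    refine PowerSeries.nat_le_order _ _ fun i hi => ?_
    rw [qExpansion_coeff_of_tendsto one_pos one_mem_strictPeriods_SL _ hlim (Nat.lt_succ_iff.mp hi)]
    simp
  have hzero : ModularForm.norm 𝒮ℒ f = 0 := by
    refine ModularForm.sturm_bound_levelOne (lt_of_lt_of_le ?_ hcoeff)
    have hd := card_quotient_GammaFour_le
    -- The norm has weight at most 48k, so the Sturm bound is at most 4k.
    have : ((k : ℤ) * (Nat.card (𝒮ℒ ⧸ GammaFour.subgroupOf 𝒮ℒ) : ℤ)).toNat / 12 ≤ 4 * k := by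
      rw [← Nat.cast_mul, Int.toNat_natCast]
      refine Nat.div_le_of_le_mul ?_
      nlinarith
    exact_mod_cast Nat.lt_succ_of_le this
  exact DFunLike.coe_injective ((ModularForm.norm_eq_zero_iff 𝒮ℒ f).mp hzero)

/-! ### Monomial bases of the graded pieces -/

/-- `x` is the homogeneous element of weight `k` given by the function `g`. -/
def IsFormOfWeight (x : ⨁ k : ℕ, NModularForm GammaFour k) (k : ℕ) (g : ℍ → ℂ) : Prop :=
  ∃ F : NModularForm GammaFour k, x = DirectSum.of (NModularForm GammaFour) k F ∧ ∀ z, F z = g z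

namespace IsFormOfWeight

variable {x y : ⨁ k : ℕ, NModularForm GammaFour k} {k l : ℕ} {g g' : ℍ → ℂ}

lemma of (f : NModularForm GammaFour k) :
    IsFormOfWeight (DirectSum.of (NModularForm GammaFour) k f) k f := ⟨f, rfl, fun _ => rfl⟩

lemma mul (hx : IsFormOfWeight x k g) (hy : IsFormOfWeight y l g') :
    IsFormOfWeight (x * y) (k + l) (g * g') := by
  obtain ⟨F, rfl, hF⟩ := hx
  obtain ⟨G, rfl, hG⟩ := hy
  refine ⟨GradedMonoid.GMul.mul F G, DirectSum.of_mul_of F G, fun z => ?_⟩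
  rw [Pi.mul_apply, ← hF, ← hG]
  rfl

lemma pow (hx : IsFormOfWeight x 1 g) : ∀ n : ℕ, IsFormOfWeight (x ^ n) n (g ^ n)
  | 0 => ⟨GradedMonoid.GOne.one, by rw [pow_zero]; rfl, fun z => by simp; rfl⟩
  | n + 1 => by
    rw [pow_succ, pow_succ]
    exact (hx.pow n).mul hx

lemma eq (hx : IsFormOfWeight x k g) (hy : IsFormOfWeight y k g) : x = y := by
  obtain ⟨F, rfl, hF⟩ := hx
  obtain ⟨G, rfl, hG⟩ := hy
  congr 1
  exact ModularForm.ext fun z => (hF z).trans (hG z).symm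

end IsFormOfWeight

open MvPolynomial in
lemma isFormOfWeight_evalForms (a b c : ℕ) :
    IsFormOfWeight (evalForms formM formN formP (X 0 ^ a * X 1 ^ b * X 2 ^ c)) (a + b + c)
      ((formM : ℍ → ℂ) ^ a * (formN : ℍ → ℂ) ^ b * (formP : ℍ → ℂ) ^ c) := by
  simp only [map_mul, map_pow, evalForms, aeval_X]
  exact (((IsFormOfWeight.of formM).pow a).mul ((IsFormOfWeight.of formN).pow b)).mul
    ((IsFormOfWeight.of formP).pow c)

/-- The monomial whose value has leading term a multiple of `q^{j/4}` in weight `k`. -/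
def triMonomial (k j : ℕ) : MvPolynomial (Fin 3) ℂ :=
  MvPolynomial.X 0 ^ (k - (j + 1) / 2) * MvPolynomial.X 1 ^ (j % 2) * MvPolynomial.X 2 ^ (j / 2)

/-- The exponents sum to k only propositionally, so the form is obtained by existence, avoiding
casts between weights. -/
lemma exists_triForm (k : ℕ) (j : Fin (2 * k + 1)) : ∃ F : NModularForm GammaFour k,
    evalForms formM formN formP (triMonomial k j) = DirectSum.of (NModularForm GammaFour) k F ∧
    ∀ z, F z = formM z ^ (k - (j + 1) / 2 : ℕ) * formN z ^ (j % 2 : ℕ) * formP z ^ (j / 2 : ℕ) := by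
  have h := isFormOfWeight_evalForms (k - (j + 1) / 2) (j % 2) (j / 2)
  rwa [show (k - (j + 1) / 2 + j % 2 + j / 2 : ℕ) = k by lia] at h

/-- The form of weight `k` given by `triMonomial k j`. -/
def triForm (k : ℕ) (j : Fin (2 * k + 1)) : NModularForm GammaFour k := (exists_triForm k j).choose

lemma evalForms_triMonomial (k : ℕ) (j : Fin (2 * k + 1)) :
    evalForms formM formN formP (triMonomial k j) =
      DirectSum.of (NModularForm GammaFour) k (triForm k j) := (exists_triForm k j).choose_spec.1

lemma triForm_apply (k : ℕ) (j : Fin (2 * k + 1)) (z : ℍ) :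
    triForm k j z = formM z ^ (k - (j + 1) / 2 : ℕ) * formN z ^ (j % 2 : ℕ) *
      formP z ^ (j / 2 : ℕ) := (exists_triForm k j).choose_spec.2 z

/-- The monomial is 2^{j % 2} times a power of θ times φ^j, and φ^j contributes 2^j q^{j/4}.
Coefficients beyond j are not needed for triangularity. -/
lemma qExpansion_coeff_triForm {k : ℕ} {i j : Fin (2 * k + 1)} (hij : i ≤ j) :
    (qExpansion 4 (triForm k j)).coeff i = if i = j then 2 ^ (j % 2 + j : ℕ) else 0 := by
  rw [qExpansion_coeff_of_tendsto (by norm_num) four_mem_strictPeriods_GammaFour (triForm k j)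
    (m := j) (c := 2 ^ (j % 2 + j : ℕ)) ?_ hij]
  · simp only [Fin.val_inj]
  have h1 := tendsto_thetaFn_atImInfty.pow (2 * (k - (j + 1) / 2) + j % 2 : ℕ)
  have h2 := (h1.mul (tendsto_phiFn_div_atImInfty.pow (j : ℕ))).const_mul (2 ^ (j % 2 : ℕ))
  rw [one_pow, one_mul, ← pow_add] at h2
  refine h2.congr fun z => ?_
  have hq := Function.Periodic.qParam_ne_zero (h := 4) z
  rw [triForm_apply, formM_apply, formN_apply, formP_apply]
  have e : phiFn z ^ (j : ℕ) = phiFn z ^ (j % 2 : ℕ) * (phiFn z ^ 2) ^ (j / 2 : ℕ) := by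
    rw [← pow_mul, ← pow_add, Nat.mod_add_div]
  rw [div_pow, e, pow_add, pow_mul, mul_pow, mul_pow]
  field_simp

/-- The first `2 k + 1` coefficients of the `q`-expansion of a form of weight `k`. -/
def coeffMap (k : ℕ) : NModularForm GammaFour k →ₗ[ℂ] (Fin (2 * k + 1) → ℂ) where
  toFun f i := (qExpansion 4 f).coeff i
  map_add' f g := by
    ext i
    rw [FunLike.coe_add, ModularForm.qExpansion_add (by norm_num) four_mem_strictPeriods_GammaFour]
    simp
  map_smul' a f := by
    ext i
    rw [FunLike.coe_smul, ModularForm.qExpansion_smul (by norm_num) four_mem_strictPeriods_GammaFour]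
    simp

lemma coeffMap_injective (k : ℕ) : Function.Injective (coeffMap k) := by
  rw [injective_iff_map_eq_zero]
  intro f hf
  exact eq_zero_of_qExpansion_coeff_eq_zero f fun i hi => congrFun hf ⟨i, hi⟩

lemma linearIndependent_triForm (k : ℕ) : LinearIndependent ℂ (triForm k) := by
  refine LinearIndependent.of_comp (coeffMap k) ?_
  let A : Matrix (Fin (2 * k + 1)) (Fin (2 * k + 1)) ℂ := fun j => coeffMap k (triForm k j)
  refine Matrix.linearIndependent_rows_of_det_ne_zero (A := A) ?_
  have hA : A.IsUpperTriangular := fun j i hij => by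
    change (qExpansion 4 (triForm k j)).coeff i = 0
    rw [qExpansion_coeff_triForm (le_of_lt (show i < j from hij)), if_neg (ne_of_lt (show i < j from hij))]
  rw [Matrix.det_of_isUpperTriangular hA, Finset.prod_ne_zero_iff]
  intro j _
  change (qExpansion 4 (triForm k j)).coeff j ≠ 0
  rw [qExpansion_coeff_triForm le_rfl, if_pos rfl]
  exact pow_ne_zero _ two_ne_zero

/-- Injectivity of `coeffMap` bounds the dimension by 2k + 1, which the independent monomials
attain. -/
lemma exists_basis_eq_triForm (k : ℕ) :
    ∃ b : Module.Basis (Fin (2 * k + 1)) ℂ (NModularForm GammaFour k), ⇑b = triForm k := by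
  have : Module.Finite ℂ (NModularForm GammaFour k) :=
    Module.Finite.of_injective _ (coeffMap_injective k)
  have h1 := LinearMap.finrank_le_finrank_of_injective (coeffMap_injective k)
  have h2 := (linearIndependent_triForm k).fintype_card_le_finrank
  rw [Module.finrank_fin_fun] at h1
  rw [Fintype.card_fin] at h2
  exact ⟨basisOfLinearIndependentOfCardEqFinrank (linearIndependent_triForm k)
    (by rw [Fintype.card_fin]; exact le_antisymm h2 h1), by simp⟩

/-! ### The relation, surjectivity and the kernel -/

/-- The relation `Y² - 4XZ`. -/
abbrev conicRelation : MvPolynomial (Fin 3) ℂ :=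
  MvPolynomial.X 1 ^ 2 - 4 * MvPolynomial.X 0 * MvPolynomial.X 2

lemma evalForms_conicRelation : evalForms formM formN formP conicRelation = 0 := by
  have h1 := isFormOfWeight_evalForms 0 2 0
  have h2 := isFormOfWeight_evalForms 1 0 1
  simp only [pow_zero, pow_one, one_mul, mul_one, zero_add, add_zero] at h1 h2
  obtain ⟨G, hG, hGz⟩ := h2
  have h3 : IsFormOfWeight (evalForms formM formN formP
      (4 * MvPolynomial.X 0 * MvPolynomial.X 2)) 2 ((formN : ℍ → ℂ) ^ 2) := by
    refine ⟨(4 : ℕ) • G, ?_, fun z => ?_⟩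
    · rw [map_nsmul, mul_assoc, map_mul, hG, map_ofNat, nsmul_eq_mul]
      rfl
    · change ((4 : ℕ) • (G : ℍ → ℂ)) z = _
      simp only [Pi.smul_apply, hGz, Pi.mul_apply, Pi.pow_apply, formM_apply, formN_apply,
        formP_apply]
      simp
      ring
  rw [conicRelation, map_sub, h1.eq h3, sub_self]

/-- Modulo the relation, every monomial is a multiple of some `triMonomial`. -/
lemma monomial_sub_mem (a b c : ℕ) : ∃ (k : ℕ) (j : Fin (2 * k + 1)) (r : ℂ),
    (MvPolynomial.X 0 ^ a * MvPolynomial.X 1 ^ b * MvPolynomial.X 2 ^ c -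
      r • triMonomial k j : MvPolynomial (Fin 3) ℂ) ∈ Ideal.span {conicRelation} := by
  -- Each of the b / 2 factors Y² becomes 4XZ. The index is 2c + b, written so that its half and
  -- parity are visible.
  refine ⟨a + b + c, ⟨2 * (c + b / 2) + b % 2, by lia⟩, 4 ^ (b / 2), ?_⟩
  rw [triMonomial]
  simp only
  rw [show a + b + c - (2 * (c + b / 2) + b % 2 + 1) / 2 = a + b / 2 by lia,
    show (2 * (c + b / 2) + b % 2) % 2 = b % 2 by lia,
    show (2 * (c + b / 2) + b % 2) / 2 = c + b / 2 by lia]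
  rw [← Ideal.Quotient.eq]
  have hrel : (Ideal.Quotient.mk (Ideal.span {conicRelation})) (MvPolynomial.X 1 ^ 2) =
      Ideal.Quotient.mk _ (4 * MvPolynomial.X 0 * MvPolynomial.X 2) :=
    Ideal.Quotient.eq.mpr (Ideal.subset_span rfl)
  have hb : (MvPolynomial.X 1 ^ b : MvPolynomial (Fin 3) ℂ) =
      (MvPolynomial.X 1 ^ 2) ^ (b / 2) * MvPolynomial.X 1 ^ (b % 2) := by
    rw [← pow_mul, ← pow_add, Nat.div_add_mod]
  have hC : MvPolynomial.C (4 ^ (b / 2) : ℂ) = (4 : MvPolynomial (Fin 3) ℂ) ^ (b / 2) := by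
    rw [map_pow, map_ofNat]
  rw [hb, MvPolynomial.smul_eq_C_mul, hC]
  rw [map_mul, map_mul, map_mul, map_pow (Ideal.Quotient.mk _) (MvPolynomial.X 1 ^ 2), hrel]
  simp only [map_mul, map_pow]
  ring

/-- Sending basis forms to their monomials gives a linear right inverse of evaluation, which serves
both surjectivity and the kernel. -/
lemma exists_linear_section : ∃ s : (⨁ k : ℕ, NModularForm GammaFour k) →ₗ[ℂ]
      MvPolynomial (Fin 3) ℂ, (∀ x, evalForms formM formN formP (s x) = x) ∧
    ∀ k j, s (DirectSum.of (NModularForm GammaFour) k (triForm k j)) = triMonomial k j := by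
  choose b hb using exists_basis_eq_triForm
  let s : (⨁ k : ℕ, NModularForm GammaFour k) →ₗ[ℂ] MvPolynomial (Fin 3) ℂ :=
    DirectSum.toModule ℂ ℕ _ fun k => (b k).constr ℂ fun j => triMonomial k j
  have hs : ∀ k j, s (DirectSum.of (NModularForm GammaFour) k (triForm k j)) =
      triMonomial k j := fun k j => by
    have := DirectSum.toModule_lof ℂ (φ := fun k => (b k).constr ℂ fun j => triMonomial k j) k
      (triForm k j)
    refine this.trans ?_
    rw [← hb, Module.Basis.constr_basis]
  refine ⟨s, ?_, hs⟩
  have hid : (evalForms formM formN formP).toLinearMap ∘ₗ s = LinearMap.id := by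
    refine DirectSum.linearMap_ext _ fun k => (b k).ext fun j => ?_
    simp only [hb]
    change evalForms formM formN formP (s (DirectSum.of (NModularForm GammaFour) k (triForm k j))) =
      DirectSum.of (NModularForm GammaFour) k (triForm k j)
    rw [hs, evalForms_triMonomial]
  exact fun x => LinearMap.congr_fun hid x

theorem proposition2p1 :
    ∃ M N P : NModularForm GammaFour 1,
      (∀ z : ℍ, M z = thetaFn z ^ 2) ∧
      (∀ z : ℍ, N z = 2 * thetaFn z * phiFn z) ∧
      (∀ z : ℍ, P z = phiFn z ^ 2) ∧
      (∃ b : Module.Basis (Fin 3) ℂ (NModularForm GammaFour 1), ⇑b = ![M, N, P]) ∧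
      Function.Surjective (evalForms M N P) ∧
      RingHom.ker (evalForms M N P) =
        Ideal.span {(MvPolynomial.X 1 ^ 2 - 4 * MvPolynomial.X 0 * MvPolynomial.X 2 :
          MvPolynomial (Fin 3) ℂ)} := by
  obtain ⟨s, hs, hsj⟩ := exists_linear_section
  refine ⟨formM, formN, formP, formM_apply, formN_apply, formP_apply, ?_, fun x => ⟨s x, hs x⟩, ?_⟩
  · obtain ⟨b, hb⟩ := exists_basis_eq_triForm 1
    refine ⟨b, ?_⟩
    rw [hb]
    ext j z
    rw [triForm_apply]
    fin_cases j <;> simp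
  · change _ = Ideal.span {conicRelation}
    refine le_antisymm ?_ ?_
    · have key : ∀ p : MvPolynomial (Fin 3) ℂ, ∃ x, p - s x ∈ Ideal.span {conicRelation} := by
        intro p
        induction p using MvPolynomial.induction_on' with
        | monomial u a =>
          obtain ⟨k, j, r, h⟩ := monomial_sub_mem (u 0) (u 1) (u 2)
          refine ⟨a • r • DirectSum.of (NModularForm GammaFour) k (triForm k j), ?_⟩
          rw [map_smul, map_smul, hsj, MvPolynomial.monomial_eq, Finsupp.prod_fintype _ _ (by simp),
            Fin.prod_univ_three, ← MvPolynomial.smul_eq_C_mul, ← smul_sub,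
            MvPolynomial.smul_eq_C_mul]
          exact Ideal.mul_mem_left _ _ h
        | add p q hp hq =>
          obtain ⟨x, hx⟩ := hp
          obtain ⟨y, hy⟩ := hq
          refine ⟨x + y, ?_⟩
          rw [map_add, add_sub_add_comm]
          exact Ideal.add_mem _ hx hy
      intro p hp
      obtain ⟨x, hx⟩ := key p
      have hle : Ideal.span {conicRelation} ≤ RingHom.ker (evalForms formM formN formP) :=
        (Ideal.span_singleton_le_iff_mem _).mpr evalForms_conicRelation
      have h0 := hle hx
      -- Evaluating p - s x, which lies in the kernel, at p in the kernel forces x = 0, so p itself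
      -- lies in the ideal.
      rw [RingHom.mem_ker, map_sub, hs, (RingHom.mem_ker).mp hp, zero_sub, neg_eq_zero] at h0
      rwa [h0, map_zero, sub_zero] at hx
    · exact (Ideal.span_singleton_le_iff_mem _).mpr evalForms_conicRelation

end
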